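/- A paratopological group is a group with a topology in which multiplication is jointly continuous (inversion need not be continuous). A Hausdorff paratopological group $G$ is called H-closed if it is closed in every Hausdorff paratopological group (abelian or not) that contains $G$ as a subgroup with the subspace topology. Let $G$ be a Hausdorff abelian topological group, written additively, that is H-closed as a paratopological group. For an integer $n \ge 1$ put $nG = \{nx : x \in G\}$, and let $K = \bigcap_{n \ge 1} \overline{nG}$. Then $K$ is compact, and for every neighborhood $U$ of zero in $G$ there exists an integer $n \ge 1$ such that $\overline{nG} \subseteq K + U$. -/

import Mathlib

open Topology
open scoped Pointwise

/-- A paratopological group is a group with a topology for which the multiplication (written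
additively here) is jointly continuous; the inversion need not be continuous. A Hausdorff
paratopological group `G` is H-closed if it is closed in every Hausdorff paratopological group `H`,
abelian or not, that contains `G` as a subgroup with the subspace topology. -/
def IsHClosedAddGroup.{u} (G : Type u) [AddGroup G] [TopologicalSpace G] [ContinuousAdd G]
    [T2Space G] : Prop :=
  ∀ (H : Type u) [AddGroup H] [TopologicalSpace H] [ContinuousAdd H] [T2Space H] (f : G →+ H),
    IsEmbedding f → IsClosed (Set.range f)

/-- The set `nG` of all `n`-fold multiples `n • x = x + ⋯ + x` of elements `x` of `G`. -/
def multiplesSet (G : Type*) [AddGroup G] (n : ℕ) : Set G :=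
  {y | ∃ x : G, n • x = y}

/-- The intersection of the closures of the sets `nG` over all positive integers `n`. -/
def multiplesCore (G : Type*) [AddGroup G] [TopologicalSpace G] : Set G :=
  ⋂ (n : ℕ) (_ : 1 ≤ n), closure (multiplesSet G n)

/-!
The heart of the matter is that in an H-closed group `G`, for every neighborhood `U` of zero, some
`nG` with `n ≥ 1` is covered by finitely many translates of `U`
(`IsHClosedAddGroup.exists_multiplesSet_covered`). Suppose that this fails for `U`. A covering
argument in the style of B. H. Neumann (`exists_forall_sub_notMem`) then yields a sequence `g k`
in `G` so sparse that no multiple `m • g k` with `0 < |m| ≤ k` is congruent, modulo a neighborhood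
of zero, to a combination of the earlier terms with suitably bounded coefficients
(`exists_sparse_sequence`).

Now `G` embeds as `G × {0}` in `G × ℤ`, where the sets
`{(v, 0) + ∑ k, c k • (g k, -1) | v ∈ V, 0 ≤ c k, n * c k ≤ k}` form a base at zero of a
paratopological group topology. As only nonnegative coefficients occur, each of them meets
`G × {0}` in `V × {0}`, so `G` keeps its topology. Sparseness of the sequence makes the topology
Hausdorff (`exists_sparseNhd_separating`). But `(g k, -1)` tends to zero, hence `(g k, 0)` tends to
`(0, 1)`, and `G` is not closed.

An H-closed `G` is also complete, being closed in its completion. By the covering property every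
ultrafilter that contains all the sets `closure (nG)` is Cauchy, so it converges, necessarily to a
point of `K = ⋂ n, closure (nG)` (`IsHClosedAddGroup.exists_ultrafilter_le_nhds`). Applied to
ultrafilters on `K`, this gives compactness. Applied to an ultrafilter containing all the sets
`closure (nG) \ (K + U)`, in case they are all nonempty, it gives a contradiction.
-/

/-! ### Paratopological extensions -/

/-- A base at zero for a Hausdorff paratopological group topology on `H` inducing the topology
of `G`, in which a point outside `G` is adherent to `G`, witnesses that `G` is not H-closed.
Symmetry of the sets `B i` is not required. -/
theorem not_isHClosedAddGroup_of_basis.{u} {G H : Type u} [AddCommGroup G] [TopologicalSpace G]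
    [IsTopologicalAddGroup G] [T2Space G] [AddCommGroup H] {ι : Type*} [Nonempty ι] (f : G →+ H)
    (B : ι → Set H) (hdir : ∀ i j, ∃ k, B k ⊆ B i ∧ B k ⊆ B j) (hzero : ∀ i, 0 ∈ B i)
    (hadd : ∀ i, ∃ j, ∀ a ∈ B j, ∀ b ∈ B j, a + b ∈ B i)
    (hsep : ∀ h, h ≠ 0 → ∃ i, ∀ a ∈ B i, ∀ b ∈ B i, a - b ≠ h)
    (hf : (𝓝 (0 : G)).HasBasis (fun _ => True) (fun i => f ⁻¹' B i))
    (x : H) (hx : x ∉ Set.range f) (hxB : ∀ i, ∃ b ∈ B i, x + b ∈ Set.range f) :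
    ¬ IsHClosedAddGroup G := by
  intro hG
  have hN : (⨅ i, Filter.principal (B i)).HasBasis (fun _ => True) B :=
    Filter.hasBasis_iInf_principal fun i j => hdir i j
  set N : Filter H := ⨅ i, Filter.principal (B i)
  let n : H → Filter H := fun a => Filter.map (fun b => a + b) N
  have hn : ∀ a, (n a).HasBasis (fun _ => True) (fun i => (fun b => a + b) '' B i) :=
    fun a => hN.map _
  let τ : TopologicalSpace H := TopologicalSpace.mkOfNhds n
  have hnhds : ∀ a : H, 𝓝 a = n a := fun a => by
    refine TopologicalSpace.nhds_mkOfNhds n a ?_ ?_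
    · intro a s hs
      obtain ⟨i, -, hi⟩ := (hn a).mem_iff.1 hs
      exact hi ⟨0, hzero i, add_zero a⟩
    · intro a s hs
      obtain ⟨i, -, hi⟩ := (hn a).mem_iff.1 hs
      obtain ⟨j, hj⟩ := hadd i
      refine (hn a).mem_iff.2 ⟨j, trivial, ?_⟩
      rintro _ ⟨b, hb, rfl⟩
      refine (hn _).mem_iff.2 ⟨j, trivial, ?_⟩
      rintro _ ⟨c, hc, rfl⟩
      exact hi ⟨b + c, hj b hb c hc, (add_assoc a b c).symm⟩
  have hb : ∀ a, (𝓝 a).HasBasis (fun _ => True) (fun i => (fun b => a + b) '' B i) := fun a => by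
    rw [hnhds]; exact hn a
  have : ContinuousAdd H := ⟨continuous_iff_continuousAt.2 fun ⟨a, b⟩ => by
    refine (((hb a).prod_nhds (hb b)).tendsto_iff (hb (a + b))).2 fun i _ => ?_
    obtain ⟨j, hj⟩ := hadd i
    refine ⟨(j, j), ⟨trivial, trivial⟩, ?_⟩
    rintro ⟨_, _⟩ ⟨⟨c, hc, rfl⟩, ⟨d, hd, rfl⟩⟩
    exact ⟨c + d, hj c hc d hd, add_add_add_comm a b c d⟩⟩
  have : T2Space H := t2Space_iff_disjoint_nhds.2 fun a b hab => by
    obtain ⟨i, hi⟩ := hsep (a - b) (sub_ne_zero.2 hab)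
    refine ((hb a).disjoint_iff (hb b)).2 ⟨i, trivial, i, trivial, ?_⟩
    rw [Set.disjoint_left]
    rintro _ ⟨c, hc, rfl⟩ ⟨d, hd, hdc⟩
    exact hi d hd c hc (sub_eq_sub_iff_add_eq_add.2 (by simpa [add_comm] using hdc))
  have hind : IsInducing f := by
    refine isInducing_iff_nhds.2 fun g => ?_
    have h1 : (𝓝 g).HasBasis (fun _ => True) (fun i => (fun b => g + b) '' (f ⁻¹' B i)) := by
      rw [← map_add_left_nhds_zero g]
      exact hf.map _
    refine h1.eq_of_same_basis ?_
    convert (hb (f g)).comap f using 2 with i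
    ext y
    constructor
    · rintro ⟨c, hc, rfl⟩
      exact ⟨f c, hc, (map_add f g c).symm⟩
    · rintro ⟨b, hb, hy⟩
      refine ⟨y - g, ?_, add_sub_cancel g y⟩
      have : f (y - g) = b := by rw [map_sub, ← hy]; exact add_sub_cancel_left _ _
      rwa [Set.mem_preimage, this]
  have hcl := hG H f hind.isEmbedding
  refine hx (hcl.closure_eq ▸ (mem_closure_iff_nhds_basis (hb x)).2 fun i _ => ?_)
  obtain ⟨b, hb, hxb⟩ := hxB i
  exact ⟨x + b, hxb, b, hb, rfl⟩

/-! ### Sparse sequences -/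

/-- B. H. Neumann's covering argument for subsets in place of subgroups: if no difference set
`C i - C i` has finitely many translates covering the group, then finitely many translates of
the sets `C i` do not cover it. -/
theorem exists_forall_sub_notMem {G ι : Type*} [AddCommGroup G] [DecidableEq ι] (C : ι → Set G)
    (s : Finset ι)
    (hC : ∀ i ∈ s, ∀ F : Finset G, ∃ g, ∀ f ∈ F, ∀ c ∈ C i, ∀ d ∈ C i, g ≠ f + (c - d)) :
    ∀ F : Finset G, ∃ g, ∀ i ∈ s, ∀ f ∈ F, g - f ∉ C i := by
  classical
  induction s using Finset.induction_on with
  | empty => exact fun F => ⟨0, by simp⟩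
  | insert a s ha ih =>
    intro F
    obtain ⟨g₀, hg₀⟩ := hC a (Finset.mem_insert_self a s) F
    -- `g₀ + C a` misses `F + C a`, so a cover by all the sets lets `F + C a` be replaced by
    -- translates of the other sets.
    obtain ⟨g, hg⟩ := ih (fun i hi => hC i (Finset.mem_insert_of_mem hi))
      (F ∪ (F ×ˢ F).image fun p => p.1 - g₀ + p.2)
    by_contra! hcov
    obtain ⟨i, hi, f, hf, hgf⟩ := hcov g
    rcases Finset.mem_insert.1 hi with rfl | hi
    · obtain ⟨j, hj, f', hf', hgf'⟩ := hcov (g₀ + (g - f))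
      rcases Finset.mem_insert.1 hj with rfl | hj
      · exact hg₀ f' hf' _ hgf' _ hgf (by abel)
      · refine hg j hj (f - g₀ + f') (Finset.mem_union_right _
          (Finset.mem_image.2 ⟨(f, f'), Finset.mem_product.2 ⟨hf, hf'⟩, rfl⟩)) ?_
        convert hgf' using 1
        abel
    · exact hg i hi f (Finset.mem_union_left _ hf) hgf

/-- If no set `nG` with `n ≥ 1` is covered by finitely many translates of `U`, then a single
element `g` can be found for which all `m • g` with `0 < |m| ≤ k` avoid `F + V`. -/
theorem exists_forall_zsmul_notMem {G : Type*} [AddCommGroup G] {U V : Set G}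
    (hU : ∀ n : ℕ, 1 ≤ n → ∀ F : Finset G, ∃ y ∈ multiplesSet G n, ∀ f ∈ F, y - f ∉ U)
    (hV : ∀ v ∈ V, ∀ w ∈ V, v - w ∈ U) (F : Finset G) (k : ℕ) :
    ∃ g : G, ∀ m : ℤ, m ≠ 0 → |m| ≤ k → ∀ f ∈ F, m • g - f ∉ V := by
  classical
  -- Differences of elements of `{g | m • g - f ∈ V}` lie in `{d | m • d ∈ U}`, and a cover of `G`
  -- by translates of the latter set would give a cover of `|m|G` by translates of `U`.
  obtain ⟨g, hg⟩ := exists_forall_sub_notMem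
    (fun p : ℤ × G => {g : G | p.1 • g - p.2 ∈ V})
    (((Finset.Icc (-k : ℤ) k).erase 0) ×ˢ F) (by
      rintro ⟨m, f⟩ hm F'
      have hm0 : m ≠ 0 := (Finset.mem_erase.1 (Finset.mem_product.1 hm).1).1
      obtain ⟨_, ⟨x, rfl⟩, hx⟩ := hU m.natAbs (Int.natAbs_pos.2 hm0)
        (F'.image fun f' => m.natAbs • (m.sign • f'))
      have hsign : ∀ z : G, m.natAbs • (m.sign • z) = m • z := fun z => by
        rw [← natCast_zsmul, smul_smul, mul_comm, Int.sign_mul_natAbs]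
      refine ⟨m.sign • x, fun f' hf' c hc d hd h => hx _ (Finset.mem_image_of_mem _ hf') ?_⟩
      have hsx : m • (m.sign • x) = m.natAbs • x := by
        rw [smul_smul, mul_comm, Int.sign_mul_self_eq_natAbs, natCast_zsmul]
      rw [← hsx, h, hsign, smul_add, smul_sub, add_sub_cancel_left]
      simpa using hV _ hc _ hd) {0}
  refine ⟨g, fun m hm hmk f hf h => hg (m, f) ?_ 0 (by simp) (by simpa using h)⟩
  exact Finset.mem_product.2 ⟨Finset.mem_erase.2 ⟨hm, Finset.mem_Icc.2 (abs_le.1 hmk)⟩, hf⟩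

/-- A sequence so sparse that, for nonzero `m` with `|m| ≤ k`, the multiple `m • g k` is not
congruent modulo `V` to any combination of earlier terms whose coefficients satisfy
`|c j| ≤ 2 * j`. -/
theorem exists_sparse_sequence {G : Type*} [AddCommGroup G] {V : Set G}
    (hV : ∀ (F : Finset G) (k : ℕ), ∃ g : G, ∀ m : ℤ, m ≠ 0 → |m| ≤ k → ∀ f ∈ F, m • g - f ∉ V) :
    ∃ g : ℕ → G, ∀ (k : ℕ) (m : ℤ), m ≠ 0 → |m| ≤ k → ∀ c : ℕ → ℤ, (∀ j, |c j| ≤ 2 * j) →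
      m • g k - ∑ j ∈ Finset.range k, c j • g j ∉ V := by
  classical
  choose s hs using hV
  -- `F k` contains all the admissible combinations of the first `k` terms `s (F j) j`.
  let F : ℕ → Finset G := Nat.rec {0} fun k Fk =>
    (Fk ×ˢ Finset.Icc (-(2 * k) : ℤ) (2 * k)).image fun p => p.1 + p.2 • s Fk k
  have hF : ∀ c : ℕ → ℤ, (∀ j, |c j| ≤ 2 * j) → ∀ k,
      ∑ j ∈ Finset.range k, c j • s (F j) j ∈ F k := fun c hc k => by
    induction k with
    | zero => exact Finset.mem_singleton_self _
    | succ k ih =>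
      rw [Finset.sum_range_succ]
      exact Finset.mem_image.2 ⟨(_, c k), Finset.mem_product.2
        ⟨ih, Finset.mem_Icc.2 (abs_le.1 (hc k))⟩, rfl⟩
  exact ⟨fun k => s (F k) k, fun k m hm hmk c hc => hs (F k) k m hm hmk _ (hF c hc k)⟩

/-! ### Asymmetric neighborhoods in `G × ℤ` -/

/-- The nonnegative finitely supported coefficient families `c` with `n * c k ≤ k` for all `k`. -/
def sparseCoeff (n : ℕ) : Set (ℕ →₀ ℤ) :=
  {c | ∀ k, 0 ≤ c k ∧ n * c k ≤ k}

/-- The set of all `(v, 0) + ∑ k, c k • (g k, -1)` in `G × ℤ` with `v ∈ V` and `c` in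
`sparseCoeff n`. Only nonnegative coefficients occur, so the set meets `G × {0}` in `V × {0}`. -/
def sparseNhd {G : Type*} [AddCommGroup G] (g : ℕ → G) (V : Set G) (n : ℕ) : Set (G × ℤ) :=
  {h | ∃ v ∈ V, ∃ c ∈ sparseCoeff n,
    h.1 = v + Finsupp.linearCombination ℤ g c ∧
      h.2 = -Finsupp.linearCombination ℤ (fun _ => (1 : ℤ)) c}

theorem sparseCoeff_antitone {m n : ℕ} (h : m ≤ n) : sparseCoeff n ⊆ sparseCoeff m :=
  fun c hc k => ⟨(hc k).1, (mul_le_mul_of_nonneg_right (by exact_mod_cast h) (hc k).1).trans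
    (hc k).2⟩

theorem sparseNhd_mono {G : Type*} [AddCommGroup G] (g : ℕ → G) {V W : Set G} (hVW : V ⊆ W)
    {m n : ℕ} (h : m ≤ n) : sparseNhd g V n ⊆ sparseNhd g W m := by
  rintro p ⟨v, hv, c, hc, hp⟩
  exact ⟨v, hVW hv, c, sparseCoeff_antitone h hc, hp⟩

theorem zero_mem_sparseNhd {G : Type*} [AddCommGroup G] (g : ℕ → G) {V : Set G} (hV : 0 ∈ V)
    (n : ℕ) : 0 ∈ sparseNhd g V n :=
  ⟨0, hV, 0, fun k => by simp, by simp, by simp⟩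

theorem add_mem_sparseNhd {G : Type*} [AddCommGroup G] (g : ℕ → G) {V W : Set G}
    (hV : ∀ v ∈ V, ∀ w ∈ V, v + w ∈ W) (n : ℕ) {a b : G × ℤ} (ha : a ∈ sparseNhd g V (2 * n))
    (hb : b ∈ sparseNhd g V (2 * n)) : a + b ∈ sparseNhd g W n := by
  obtain ⟨v, hv, c, hc, hac, hac'⟩ := ha
  obtain ⟨w, hw, d, hd, hbd, hbd'⟩ := hb
  refine ⟨v + w, hV v hv w hw, c + d, fun k => ?_, ?_, ?_⟩
  · obtain ⟨h1, h2⟩ := hc k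
    obtain ⟨h3, h4⟩ := hd k
    push_cast at h2 h4
    rw [Finsupp.add_apply]
    constructor <;> linarith
  · rw [Prod.fst_add, hac, hbd, map_add, add_add_add_comm]
  · rw [Prod.snd_add, hac', hbd', map_add, neg_add]

theorem mk_zero_mem_sparseNhd {G : Type*} [AddCommGroup G] (g : ℕ → G) (V : Set G) (n : ℕ)
    (a : G) : (a, (0 : ℤ)) ∈ sparseNhd g V n ↔ a ∈ V := by
  constructor
  · rintro ⟨v, hv, c, hc, h1, h2⟩
    have hc0 : c = 0 := by
      rw [Finsupp.linearCombination_apply, Finsupp.sum, eq_comm, neg_eq_zero,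
        Finset.sum_eq_zero_iff_of_nonneg fun k _ => by simpa using (hc k).1] at h2
      ext k
      by_contra hk
      exact hk (by simpa using h2 k (Finsupp.mem_support_iff.2 hk))
    subst hc0
    simp only [map_zero, add_zero] at h1
    exact h1 ▸ hv
  · exact fun ha => ⟨a, ha, 0, fun k => by simp, by simp, by simp⟩

theorem generator_mem_sparseNhd {G : Type*} [AddCommGroup G] (g : ℕ → G) {V : Set G} (hV : 0 ∈ V)
    (n : ℕ) : (g n, -1) ∈ sparseNhd g V n := by
  refine ⟨0, hV, Finsupp.single n 1, fun k => ?_, by simp, by simp⟩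
  rcases eq_or_ne n k with rfl | h
  · simp
  · simp [Finsupp.single_eq_of_ne h.symm]

theorem linearCombination_eq_sum_range {G : Type*} [AddCommGroup G] (g : ℕ → G) {d : ℕ →₀ ℤ}
    {k : ℕ} (hd : ∀ j, k < j → d j = 0) :
    Finsupp.linearCombination ℤ g d = ∑ j ∈ Finset.range k, d j • g j + d k • g k := by
  rw [← Finset.sum_range_succ, Finsupp.linearCombination_apply]
  refine Finsupp.sum_of_support_subset d (fun j hj => ?_) _ fun j _ => zero_smul ℤ (g j)
  by_contra hjk
  exact Finsupp.mem_support_iff.1 hj (hd j (by simpa [Nat.lt_succ_iff] using hjk))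

/-- For a sparse sequence, a given `a` is a combination modulo `V`, with coefficients
`|d j| ≤ j`, for at most one value of the largest index involved. -/
theorem top_index_unique {G : Type*} [AddCommGroup G] {g : ℕ → G} {V W : Set G}
    (hg : ∀ (k : ℕ) (m : ℤ), m ≠ 0 → |m| ≤ k → ∀ c : ℕ → ℤ, (∀ j, |c j| ≤ 2 * j) →
      m • g k - ∑ j ∈ Finset.range k, c j • g j ∉ W)
    (hVW : ∀ v ∈ V, ∀ w ∈ V, v - w ∈ W) {a : G} {d e : ℕ →₀ ℤ} {k l : ℕ}
    (hd : ∀ j, |d j| ≤ j) (he : ∀ j, |e j| ≤ j) (hdk : ∀ j, k < j → d j = 0)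
    (hel : ∀ j, l < j → e j = 0) (hl : e l ≠ 0)
    (had : a - Finsupp.linearCombination ℤ g d ∈ V)
    (hae : a - Finsupp.linearCombination ℤ g e ∈ V) : l ≤ k := by
  by_contra! hkl
  refine hg l (e l) hl (he l) (fun j => d j - e j) (fun j => ?_) ?_
  · have := abs_sub (d j) (e j)
    linarith [hd j, he j]
  · have h := hVW _ had _ hae
    rw [linearCombination_eq_sum_range g hel, linearCombination_eq_sum_range (k := l) g
      fun j hj => hdk j (hkl.trans hj), hdk l hkl] at h
    convert h using 1
    simp only [sub_smul, Finset.sum_sub_distrib, zero_smul]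
    abel

/-- The sets `sparseNhd g V n` separate points when `g` is sparse: a representation of
`h` as a difference has a largest index that depends on `h.1` only, and taking `n` beyond that
index forces all coefficients to vanish. -/
theorem exists_sparseNhd_separating {G : Type*} [AddCommGroup G] [TopologicalSpace G]
    [IsTopologicalAddGroup G] [T2Space G] {g : ℕ → G} {W : Set G} (hW : W ∈ 𝓝 (0 : G))
    (hg : ∀ (k : ℕ) (m : ℤ), m ≠ 0 → |m| ≤ k → ∀ c : ℕ → ℤ, (∀ j, |c j| ≤ 2 * j) →
      m • g k - ∑ j ∈ Finset.range k, c j • g j ∉ W) {h : G × ℤ} (hh : h ≠ 0) :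
    ∃ V ∈ 𝓝 (0 : G), ∃ n : ℕ, ∀ a ∈ sparseNhd g V n, ∀ b ∈ sparseNhd g V n, a - b ≠ h := by
  obtain ⟨V₁, hV₁, hV₁W⟩ := exists_nhds_half_neg hW
  obtain ⟨V₂, hV₂, hV₂V₁⟩ := exists_nhds_half_neg hV₁
  obtain ⟨V₃, hV₃, hV₃h⟩ : ∃ V ∈ 𝓝 (0 : G), h.1 ≠ 0 → ∀ v ∈ V, ∀ w ∈ V, v - w ≠ h.1 := by
    by_cases h1 : h.1 = 0
    · exact ⟨Set.univ, Filter.univ_mem, fun h => (h h1).elim⟩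
    · obtain ⟨V, hV, hVh⟩ := exists_nhds_half_neg (s := {h.1}ᶜ) (isOpen_compl_singleton.mem_nhds (Ne.symm h1))
      exact ⟨V, hV, fun _ => hVh⟩
  -- A bound on the largest index of every representation of `h.1` modulo `V₁`.
  obtain ⟨N, hN⟩ : ∃ N : ℕ, ∀ (d : ℕ →₀ ℤ) (k : ℕ), (∀ j, |d j| ≤ j) → (∀ j, k < j → d j = 0) →
      d k ≠ 0 → h.1 - Finsupp.linearCombination ℤ g d ∈ V₁ → k ≤ N := by
    by_cases hex : ∃ (d : ℕ →₀ ℤ) (k : ℕ), (∀ j, |d j| ≤ j) ∧ (∀ j, k < j → d j = 0) ∧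
        d k ≠ 0 ∧ h.1 - Finsupp.linearCombination ℤ g d ∈ V₁
    · obtain ⟨d, k, hd, hdk, -, hdV⟩ := hex
      exact ⟨k, fun e l he hel hl heV => top_index_unique hg hV₁W hd he hdk hel hl hdV heV⟩
    · exact ⟨0, fun d k h1 h2 h3 h4 => (hex ⟨d, k, h1, h2, h3, h4⟩).elim⟩
  refine ⟨V₂ ∩ V₃, Filter.inter_mem hV₂ hV₃, N + 1, ?_⟩
  rintro a ⟨v, hv, c, hc, hac, hac'⟩ b ⟨w, hw, e, he, hbe, hbe'⟩ rfl
  have h1 : (a - b).1 = v - w + Finsupp.linearCombination ℤ g (c - e) := by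
    rw [Prod.fst_sub, hac, hbe, map_sub]
    abel
  have h2 : (a - b).2 = -Finsupp.linearCombination ℤ (fun _ => (1 : ℤ)) (c - e) := by
    rw [Prod.snd_sub, hac', hbe', map_sub]
    abel
  have hbound : ∀ j, ((N + 1 : ℕ) : ℤ) * |(c - e) j| ≤ j := fun j => by
    rw [← abs_of_nonneg (Int.natCast_nonneg (N + 1)), ← abs_mul, Finsupp.sub_apply, mul_sub]
    obtain ⟨h3, h4⟩ := hc j
    obtain ⟨h5, h6⟩ := he j
    have h7 := mul_nonneg (Int.natCast_nonneg (N + 1)) h3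
    have h8 := mul_nonneg (Int.natCast_nonneg (N + 1)) h5
    exact abs_le.2 ⟨by linarith, by linarith⟩
  by_cases hce : c - e = 0
  · simp only [hce, map_zero, add_zero, neg_zero] at h1 h2
    by_cases h0 : (a - b).1 = 0
    · exact hh (Prod.ext h0 h2)
    · exact hV₃h h0 v hv.2 w hw.2 h1.symm
  · obtain ⟨k, hk, hmax⟩ := (c - e).support.exists_max_image id
      (Finsupp.support_nonempty_iff.2 hce)
    have hk0 : (c - e) k ≠ 0 := Finsupp.mem_support_iff.1 hk
    have hkN : k ≤ N := by
      refine hN (c - e) k (fun j => le_trans ?_ (hbound j)) (fun j hj => ?_) hk0 ?_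
      · exact le_mul_of_one_le_left (abs_nonneg _) (by push_cast; linarith [Int.natCast_nonneg N])
      · by_contra hj0
        exact absurd (hmax j (Finsupp.mem_support_iff.2 hj0)) (not_le.2 hj)
      · rw [h1, add_sub_cancel_right]
        exact hV₂V₁ v hv.1 w hw.1
    have h3 := hbound k
    have h4 : 1 ≤ |(c - e) k| := Int.one_le_abs hk0
    have h5 : ((N + 1 : ℕ) : ℤ) ≤ k := by nlinarith [Int.natCast_nonneg (N + 1)]
    omega

/-! ### Consequences of H-closedness -/

/-- In an H-closed abelian topological group some `nG` with `n ≥ 1` is covered by finitely many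
translates of a given neighborhood of zero. -/
theorem IsHClosedAddGroup.exists_multiplesSet_covered {G : Type*} [AddCommGroup G]
    [TopologicalSpace G] [IsTopologicalAddGroup G] [T2Space G] (hG : IsHClosedAddGroup G)
    {U : Set G} (hU : U ∈ 𝓝 (0 : G)) :
    ∃ n : ℕ, 1 ≤ n ∧ ∃ F : Finset G, ∀ y ∈ multiplesSet G n, ∃ f ∈ F, y - f ∈ U := by
  by_contra! hcon
  obtain ⟨V, hV, hVU⟩ := exists_nhds_half_neg hU
  obtain ⟨g, hg⟩ := exists_sparse_sequence (exists_forall_zsmul_notMem hcon hVU)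
  have : Nonempty {V // V ∈ 𝓝 (0 : G)} := ⟨⟨Set.univ, Filter.univ_mem⟩⟩
  refine not_isHClosedAddGroup_of_basis (ι := {V // V ∈ 𝓝 (0 : G)} × ℕ) (AddMonoidHom.inl G ℤ)
    (fun i => sparseNhd g i.1 i.2) ?_ ?_ ?_ ?_ ?_ (0, 1) ?_ ?_ hG
  · rintro ⟨V, m⟩ ⟨W, n⟩
    exact ⟨(⟨V ∩ W, Filter.inter_mem V.2 W.2⟩, max m n),
      sparseNhd_mono g Set.inter_subset_left (le_max_left m n),
      sparseNhd_mono g Set.inter_subset_right (le_max_right m n)⟩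
  · exact fun i => zero_mem_sparseNhd g (mem_of_mem_nhds i.1.2) i.2
  · rintro ⟨⟨W, hW⟩, n⟩
    obtain ⟨V, hV, hVW⟩ := exists_nhds_zero_half hW
    exact ⟨(⟨V, hV⟩, 2 * n), fun a ha b hb => add_mem_sparseNhd g hVW n ha hb⟩
  · intro h hh
    obtain ⟨W, hW, n, hn⟩ := exists_sparseNhd_separating hV hg hh
    exact ⟨(⟨W, hW⟩, n), hn⟩
  · have hpre : ∀ (V : Set G) (n : ℕ), AddMonoidHom.inl G ℤ ⁻¹' sparseNhd g V n = V :=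
      fun V n => Set.ext fun a => mk_zero_mem_sparseNhd g V n a
    refine ⟨fun S => ⟨fun hS => ⟨(⟨S, hS⟩, 0), trivial, (hpre S 0).subset⟩, ?_⟩⟩
    rintro ⟨⟨⟨V, hV⟩, n⟩, -, hVS⟩
    rw [hpre] at hVS
    exact Filter.mem_of_superset hV hVS
  · rintro ⟨a, ha⟩
    exact zero_ne_one (congrArg Prod.snd ha)
  · rintro ⟨V, n⟩
    exact ⟨(g n, -1), generator_mem_sparseNhd g (mem_of_mem_nhds V.2) n, g n, by simp⟩

/-- The completion is a Hausdorff topological group, in which an H-closed group is closed. -/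
theorem IsHClosedAddGroup.completeSpace {G : Type*} [AddCommGroup G] [UniformSpace G]
    [IsUniformAddGroup G] [T2Space G] (hG : IsHClosedAddGroup G) : CompleteSpace G := by
  have he := UniformSpace.Completion.isUniformEmbedding_coe G
  exact (completeSpace_iff_isComplete_range he.isUniformInducing).2
    (hG (UniformSpace.Completion G) UniformSpace.Completion.toCompl he.isEmbedding).isComplete

theorem multiplesSet_subset_of_dvd {G : Type*} [AddCommGroup G] {m n : ℕ} (h : m ∣ n) :
    multiplesSet G n ⊆ multiplesSet G m := by
  rintro _ ⟨x, rfl⟩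
  obtain ⟨k, rfl⟩ := h
  exact ⟨k • x, (mul_smul m k x).symm⟩

/-- An ultrafilter containing every `closure (multiplesSet G n)` is Cauchy, because some
`multiplesSet G n` is covered by finitely many small sets. -/
theorem IsHClosedAddGroup.exists_ultrafilter_le_nhds {G : Type*} [AddCommGroup G]
    [TopologicalSpace G] [IsTopologicalAddGroup G] [T2Space G] (hG : IsHClosedAddGroup G)
    (u : Ultrafilter G) (hu : ∀ n : ℕ, 1 ≤ n → closure (multiplesSet G n) ∈ u) :
    ∃ x ∈ multiplesCore G, ↑u ≤ 𝓝 x := by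
  let _ := IsTopologicalAddGroup.rightUniformSpace G
  have : IsUniformAddGroup G := isUniformAddGroup_of_addCommGroup
  have : CompleteSpace G := hG.completeSpace
  have hcauchy : Cauchy (u : Filter G) := by
    refine ⟨u.neBot, ?_⟩
    rw [uniformity_eq_comap_nhds_zero, ← Filter.tendsto_iff_comap]
    intro W hW
    obtain ⟨V, hV, hVW⟩ := exists_nhds_half_neg hW
    obtain ⟨C, hC, hCcl, hCV⟩ := exists_mem_nhds_isClosed_subset hV
    obtain ⟨n, hn, F, hF⟩ := hG.exists_multiplesSet_covered hC
    have hcov : closure (multiplesSet G n) ⊆ ⋃ f ∈ (F : Set G), {y | y - f ∈ C} := by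
      refine closure_minimal (fun y hy => ?_) ?_
      · simpa using hF y hy
      · exact F.finite_toSet.isClosed_biUnion fun f _ =>
          hCcl.preimage (continuous_id.sub continuous_const)
    obtain ⟨f, -, hf⟩ := (Ultrafilter.finite_biUnion_mem_iff F.finite_toSet).1
      (Filter.mem_of_superset (hu n hn) hcov)
    refine Filter.mem_map.2 (Filter.mem_of_superset (Filter.prod_mem_prod hf hf) ?_)
    rintro ⟨a, b⟩ ⟨ha, hb⟩
    simpa using hVW _ (hCV hb) _ (hCV ha)
  obtain ⟨x, hx⟩ := CompleteSpace.complete hcauchy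
  refine ⟨x, Set.mem_iInter₂.2 fun n hn => ?_, hx⟩
  rw [← closure_closure, mem_closure_iff_ultrafilter]
  exact ⟨u, hu n hn, hx⟩

theorem mainTheorem2 {G : Type*} [AddCommGroup G] [TopologicalSpace G] [IsTopologicalAddGroup G]
    [T2Space G] (hG : IsHClosedAddGroup G) :
    IsCompact (multiplesCore G) ∧
      ∀ U ∈ 𝓝 (0 : G), ∃ n : ℕ, 1 ≤ n ∧ closure (multiplesSet G n) ⊆ multiplesCore G + U := by
  refine ⟨isCompact_iff_ultrafilter_le_nhds.2 fun u hu => ?_, fun U hU => ?_⟩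
  · exact hG.exists_ultrafilter_le_nhds u fun n hn => Filter.mem_of_superset
      (Filter.le_principal_iff.1 hu) (Set.biInter_subset_of_mem hn)
  · by_contra! hcon
    -- The sets `closure (nG) \ (K + U)` generate a proper filter; an ultrafilter finer than it
    -- would converge to a point of `K` although it contains the complement of `K + U`.
    let D : {n : ℕ // 1 ≤ n} → Set G := fun n =>
      closure (multiplesSet G n) \ (multiplesCore G + U)
    have hmono : ∀ {m n : {n : ℕ // 1 ≤ n}}, (m : ℕ) ∣ n → D n ⊆ D m := fun h =>
      Set.sdiff_subset_sdiff_left (closure_mono (multiplesSet_subset_of_dvd h))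
    have hdir : Directed (· ≥ ·) fun n => Filter.principal (D n) := fun m n =>
      ⟨⟨m * n, Nat.mul_pos m.2 n.2⟩,
        Filter.principal_mono.2 (hmono (Dvd.intro _ rfl)),
        Filter.principal_mono.2 (hmono (Dvd.intro_left _ rfl))⟩
    have : Nonempty {n : ℕ // 1 ≤ n} := ⟨⟨1, le_rfl⟩⟩
    have hne : (⨅ n, Filter.principal (D n)).NeBot := Filter.iInf_neBot_of_directed hdir fun n =>
      Filter.principal_neBot_iff.2 (Set.sdiff_nonempty.2 (hcon n n.2))
    obtain ⟨u, hu⟩ := Ultrafilter.exists_le (⨅ n, Filter.principal (D n))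
    have huD : ∀ n, D n ∈ u := fun n => hu (Filter.mem_iInf_of_mem n (Filter.mem_principal_self _))
    obtain ⟨x, hx, hux⟩ := hG.exists_ultrafilter_le_nhds u fun n hn =>
      Filter.mem_of_superset (huD ⟨n, hn⟩) Set.sdiff_subset
    have hxU : multiplesCore G + U ∈ u := by
      refine hux ?_
      rw [← map_add_left_nhds_zero x]
      exact Filter.mem_of_superset (Filter.image_mem_map hU)
        (Set.image_subset_iff.2 fun v hv => Set.add_mem_add hx hv)
    have hempty := Filter.inter_mem hxU (huD ⟨1, le_rfl⟩)
    rw [Set.inter_sdiff_self] at hempty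
    exact u.empty_notMem hempty
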